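/- For real parameters $\alpha,\beta,\gamma,A,B,C$ consider the cubic Kolmogorov vector field $\mathcal X=(P,Q,R)$ on $\mathbb{S}^2$, with $$P=x(\alpha(1-x^2-y^2-z^2)+Ay^2+Bz^2),\quad Q=y(\beta(1-x^2-y^2-z^2)-Ax^2+Cz^2),\quad R=z(\gamma(1-x^2-y^2-z^2)-Bx^2-Cy^2).$$ Stereographic projection from the South pole, $(x,y,z)\mapsto(u,v)=\left(\frac{x}{1+z},\frac{y}{1+z}\right)$, induces (after multiplication by a positive factor) the polynomial planar system $$\dot u=\mathcal P=\tilde P-u\tilde R,\qquad \dot v=\mathcal Q=\tilde Q-v\tilde R,$$ where for a polynomial $p=\sum p_{ijk}x^iy^jz^k$ of degree at most $3$ we put $\tilde p(u,v)=\sum p_{ijk}(2u)^i(2v)^j(1-u^2-v^2)^k(u^2+v^2+1)^{3-i-j-k}$. Theorem. Let $B<0$ and $C>0$. There is a constant $A_0$, depending only on $B$ and $C$, such that for all $A>\max(A_0,0)$ and all $\alpha,\beta,\gamma\in\mathbb R$ the following hold for the point $$(u_0,v_0)=\left(\frac{\sqrt{C}}{\sqrt{A+C-B}+\sqrt{A}},\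 \frac{\sqrt{-B}}{\sqrt{A+C-B}+\sqrt{A}}\right).$$ 1. $(u_0,v_0)$ is a singular point of the planar system: $\mathcal P(u_0,v_0)=\mathcal Q(u_0,v_0)=0$. 2. The eigenvalues of the Jacobian matrix $\begin{pmatrix}\mathcal P_u&\mathcal P_v\\ \mathcal Q_u&\mathcal Q_v\end{pmatrix}$ at $(u_0,v_0)$ form a pair of complex conjugate non-real numbers $\mu\pm i\nu$, with $\mu,\nu\in\mathbb R$ and $\nu\neq0$. 3. $(u_0,v_0)$ is a center or a focus of the planar system. Here a singular point $p$ is a center if every solution curve through a point of some deleted neighbourhood of $p$ is a closed curve with $p$ in its interior. It is a focus if there is a deleted neighbourhood of $p$ such that, in polar coordinates $(r,\theta)$ about $p$ with $\theta$ continuous along solutions, the solution starting at any point of this neighbourhood satisfies $r(t)\to0$ and $|\theta(t)|\to\infty$ as $t\to\infty$ (stable focus), or the same holds for all of these solutions as $t\to-\infty$ (unstable focus). -/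

import Mathlib

open MvPolynomial Filter Topology

noncomputable section

/-- A polynomial vector field `P ∂/∂x + Q ∂/∂y + R ∂/∂z` on `ℝ³`, as the triple `(P, Q, R)`. -/
abbrev PolyField3 : Type := Fin 3 → MvPolynomial (Fin 3) ℝ

/-- The cubic Kolmogorov vector field with parameters `α, β, γ, A, B, C`. -/
def kolmogorovField (α β γ A B C : ℝ) : PolyField3 :=
  let x : MvPolynomial (Fin 3) ℝ := X 0
  let y : MvPolynomial (Fin 3) ℝ := X 1
  let z : MvPolynomial (Fin 3) ℝ := X 2
  let a (r : ℝ) : MvPolynomial (Fin 3) ℝ := MvPolynomial.C r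
  ![x * (a α * (1 - x ^ 2 - y ^ 2 - z ^ 2) + a A * y ^ 2 + a B * z ^ 2),
    y * (a β * (1 - x ^ 2 - y ^ 2 - z ^ 2) - a A * x ^ 2 + a C * z ^ 2),
    z * (a γ * (1 - x ^ 2 - y ^ 2 - z ^ 2) - a B * x ^ 2 - a C * y ^ 2)]

/-- The stereographic projection `Φ(x, y, z) = (x / (1 + z), y / (1 + z))` of the unit sphere
from the South pole `(0, 0, -1)`. -/
def stereoSouth (p : Fin 3 → ℝ) : ℝ × ℝ := (p 0 / (1 + p 2), p 1 / (1 + p 2))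

/-- For `p = ∑ p_{ijk} x^i y^j z^k` of degree at most `n`, the polynomial function
`∑ p_{ijk} (2u)^i (2v)^j (1 - u² - v²)^k (u² + v² + 1)^(n - i - j - k)` at `w = (u, v)`. -/
def stereoTilde (n : ℕ) (p : MvPolynomial (Fin 3) ℝ) (w : ℝ × ℝ) : ℝ :=
  ∑ m ∈ p.support, p.coeff m * (2 * w.1) ^ m 0 * (2 * w.2) ^ m 1 *
    (1 - w.1 ^ 2 - w.2 ^ 2) ^ m 2 * (w.1 ^ 2 + w.2 ^ 2 + 1) ^ (n - m 0 - m 1 - m 2)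

/-- The planar vector field induced by a polynomial vector field `(P, Q, R)` of degree at most `n`
under the stereographic projection from the South pole:
`u' = P~ - u R~`, `v' = Q~ - v R~`. -/
def stereoField (n : ℕ) (F : PolyField3) (w : ℝ × ℝ) : ℝ × ℝ :=
  (stereoTilde n (F 0) w - w.1 * stereoTilde n (F 2) w,
   stereoTilde n (F 1) w - w.2 * stereoTilde n (F 2) w)

/-- The stereographic projection to the plane of the cubic Kolmogorov vector field. -/
def projectedKolmogorov (α β γ A B C : ℝ) : ℝ × ℝ → ℝ × ℝ :=
  stereoField 3 (kolmogorovField α β γ A B C)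

/-- The extra singular point `(u₀, v₀)`, written with real square roots
(the case of interest is `A, C > 0`, `B < 0`). -/
def extraSing (A B C : ℝ) : ℝ × ℝ :=
  (√C / (√(A + C - B) + √A), √(-B) / (√(A + C - B) + √A))

/-- The Jacobian matrix of partial derivatives of a planar vector field at a point. -/
def planarJacobian (f : ℝ × ℝ → ℝ × ℝ) (p : ℝ × ℝ) : Matrix (Fin 2) (Fin 2) ℝ :=
  !![deriv (fun u => (f (u, p.2)).1) p.1, deriv (fun v => (f (p.1, v)).1) p.2;
     deriv (fun u => (f (u, p.2)).2) p.1, deriv (fun v => (f (p.1, v)).2) p.2]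

/-- The singular point `p` of `f` is a center: every solution curve through a point of some deleted
neighbourhood of `p` is a closed curve (the image of a periodic solution) with `p` in its interior,
that is, `p` lies in a bounded connected component of the complement of the curve. (A constant
solution is thereby excluded, since the complement of a point in the plane is connected.) -/
def IsCenter (f : ℝ × ℝ → ℝ × ℝ) (p : ℝ × ℝ) : Prop :=
  f p = 0 ∧ ∀ᶠ q in 𝓝[≠] p, ∃ γ : ℝ → ℝ × ℝ,
    IsIntegralCurve γ (fun _ => f) ∧ γ 0 = q ∧
    (∃ T : ℝ, 0 < T ∧ Function.Periodic γ T) ∧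
    p ∉ Set.range γ ∧ Bornology.IsBounded (connectedComponentIn (Set.range γ)ᶜ p)

/-- The singular point `p` of `f` is a stable focus: for the solution starting at any point of
some deleted neighbourhood of `p`, in polar coordinates `(r, θ)` about `p`, with `θ` continuous,
`r(t) → 0` and `|θ(t)| → ∞` as `t → ∞`. -/
def IsStableFocus (f : ℝ × ℝ → ℝ × ℝ) (p : ℝ × ℝ) : Prop :=
  f p = 0 ∧ ∀ᶠ q in 𝓝[≠] p, ∃ (γ : ℝ → ℝ × ℝ) (r θ : ℝ → ℝ),
    IsIntegralCurveOn γ (fun _ => f) (Set.Ici 0) ∧ γ 0 = q ∧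
    ContinuousOn θ (Set.Ici 0) ∧
    (∀ t, 0 ≤ t → 0 < r t ∧ γ t = p + (r t * Real.cos (θ t), r t * Real.sin (θ t))) ∧
    Tendsto r atTop (𝓝 0) ∧ Tendsto (fun t => |θ t|) atTop atTop

/-- Unstable focus: the same as `t → -∞`. -/
def IsUnstableFocus (f : ℝ × ℝ → ℝ × ℝ) (p : ℝ × ℝ) : Prop :=
  f p = 0 ∧ ∀ᶠ q in 𝓝[≠] p, ∃ (γ : ℝ → ℝ × ℝ) (r θ : ℝ → ℝ),
    IsIntegralCurveOn γ (fun _ => f) (Set.Iic 0) ∧ γ 0 = q ∧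
    ContinuousOn θ (Set.Iic 0) ∧
    (∀ t, t ≤ 0 → 0 < r t ∧ γ t = p + (r t * Real.cos (θ t), r t * Real.sin (θ t))) ∧
    Tendsto r atBot (𝓝 0) ∧ Tendsto (fun t => |θ t|) atBot atTop

/-- A focus is a stable or an unstable focus. -/
def IsFocus (f : ℝ × ℝ → ℝ × ℝ) (p : ℝ × ℝ) : Prop :=
  IsStableFocus f p ∨ IsUnstableFocus f p

/-- `p~` is `(1 + u² + v²)^n` times `p` evaluated at the inverse stereographic image. -/
theorem stereoTilde_eq_eval (n : ℕ) (p : MvPolynomial (Fin 3) ℝ) (hp : p.totalDegree ≤ n)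
    (w : ℝ × ℝ) :
    stereoTilde n p w = (w.1 ^ 2 + w.2 ^ 2 + 1) ^ n *
      eval ![2 * w.1 / (w.1 ^ 2 + w.2 ^ 2 + 1), 2 * w.2 / (w.1 ^ 2 + w.2 ^ 2 + 1),
        (1 - w.1 ^ 2 - w.2 ^ 2) / (w.1 ^ 2 + w.2 ^ 2 + 1)] p := by
  have hs : (w.1 ^ 2 + w.2 ^ 2 + 1) ≠ 0 := by positivity
  rw [stereoTilde, eval_eq', Finset.mul_sum]
  refine Finset.sum_congr rfl fun m hm => ?_
  have hle : m 0 + m 1 + m 2 ≤ n := by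
    have h := (le_totalDegree hm).trans hp
    rwa [Finsupp.sum_fintype _ _ (fun _ => rfl), Fin.sum_univ_three] at h
  obtain ⟨k, rfl⟩ := Nat.exists_eq_add_of_le hle
  have hk : m 0 + m 1 + m 2 + k - m 0 - m 1 - m 2 = k := by omega
  rw [hk, Fin.prod_univ_three]
  simp only [Matrix.cons_val_zero, Matrix.cons_val_one, Matrix.cons_val, div_pow, pow_add]
  field_simp

theorem kolmogorovField_totalDegree_le (α β γ A B C : ℝ) (i : Fin 3) :
    (kolmogorovField α β γ A B C i).totalDegree ≤ 3 := by
  have hC : ∀ (r : ℝ) (q : MvPolynomial (Fin 3) ℝ), q.totalDegree ≤ 2 →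
      (MvPolynomial.C r * q).totalDegree ≤ 2 := fun r q hq =>
    (totalDegree_mul _ _).trans (by rw [totalDegree_C]; omega)
  have hX : ∀ i : Fin 3, ((X i : MvPolynomial (Fin 3) ℝ) ^ 2).totalDegree ≤ 2 := fun i => by
    rw [totalDegree_X_pow]
  have hs : ∀ p q : MvPolynomial (Fin 3) ℝ, p.totalDegree ≤ 2 → q.totalDegree ≤ 2 →
      (p - q).totalDegree ≤ 2 := fun p q h1 h2 => (totalDegree_sub _ _).trans (max_le h1 h2)
  have ha : ∀ p q : MvPolynomial (Fin 3) ℝ, p.totalDegree ≤ 2 → q.totalDegree ≤ 2 →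
      (p + q).totalDegree ≤ 2 := fun p q h1 h2 => (totalDegree_add _ _).trans (max_le h1 h2)
  have h1 : (1 - X 0 ^ 2 - X 1 ^ 2 - X 2 ^ 2 : MvPolynomial (Fin 3) ℝ).totalDegree ≤ 2 :=
    hs _ _ (hs _ _ (hs _ _ (by simp) (hX 0)) (hX 1)) (hX 2)
  have hm : ∀ (i : Fin 3) (q : MvPolynomial (Fin 3) ℝ), q.totalDegree ≤ 2 →
      (X i * q).totalDegree ≤ 3 := fun i q hq =>
    (totalDegree_mul _ _).trans (by rw [totalDegree_X]; omega)
  fin_cases i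
  · exact hm 0 _ (ha _ _ (ha _ _ (hC _ _ h1) (hC _ _ (hX 1))) (hC _ _ (hX 2)))
  · exact hm 1 _ (ha _ _ (hs _ _ (hC _ _ h1) (hC _ _ (hX 0))) (hC _ _ (hX 2)))
  · exact hm 2 _ (hs _ _ (hs _ _ (hC _ _ h1) (hC _ _ (hX 0))) (hC _ _ (hX 1)))

/-- The explicit form of the projected system; it does not depend on `α, β, γ`. -/
theorem projectedKolmogorov_apply (α β γ A B C u v : ℝ) :
    projectedKolmogorov α β γ A B C (u, v) =
      (2 * u * (4 * A * v ^ 2 + B * (1 - u ^ 2 - v ^ 2) ^ 2)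
          - u * (-4 * (1 - u ^ 2 - v ^ 2) * (B * u ^ 2 + C * v ^ 2)),
       2 * v * (-4 * A * u ^ 2 + C * (1 - u ^ 2 - v ^ 2) ^ 2)
          - v * (-4 * (1 - u ^ 2 - v ^ 2) * (B * u ^ 2 + C * v ^ 2))) := by
  have hs : (u ^ 2 + v ^ 2 + 1) ≠ 0 := by positivity
  have h := fun i => stereoTilde_eq_eval 3 _ (kolmogorovField_totalDegree_le α β γ A B C i) (u, v)
  simp only [projectedKolmogorov, stereoField, h]
  simp only [kolmogorovField, Matrix.cons_val_zero, Matrix.cons_val_one, Matrix.cons_val,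
    map_mul, map_add, map_sub, map_pow, map_one, eval_X, eval_C]
  ext
  · simp only
    field_simp
    ring
  · simp only
    field_simp
    ring

/-- `(u₀, v₀)` is the stereographic image of the singular point of the vector field on the sphere
whose coordinates are `√(-C/(B-A-C))`, `√(B/(B-A-C))`, `√(-A/(B-A-C))`. -/
theorem extraSing_eq_stereoSouth (A B C : ℝ) (hA : 0 < A) (hB : B < 0) (hC : 0 < C) :
    extraSing A B C = stereoSouth
      ![√(-C / (B - A - C)), √(B / (B - A - C)), √(-A / (B - A - C))] := by
  have hS : 0 < A + C - B := by linarith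
  have h0 : 0 < √(A + C - B) := Real.sqrt_pos.2 hS
  have e1 : -C / (B - A - C) = C / (A + C - B) := by
    rw [← neg_div_neg_eq]; congr 1 <;> ring
  have e2 : B / (B - A - C) = -B / (A + C - B) := by
    rw [← neg_div_neg_eq]; congr 1; ring
  have e3 : -A / (B - A - C) = A / (A + C - B) := by
    rw [← neg_div_neg_eq]; congr 1 <;> ring
  have hA' : 0 ≤ √A := Real.sqrt_nonneg A
  simp only [extraSing, stereoSouth, Matrix.cons_val_zero, Matrix.cons_val_one, Matrix.cons_val,
    e1, e2, e3, Real.sqrt_div hA.le, Real.sqrt_div hC.le,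
    Real.sqrt_div (neg_pos.2 hB).le]
  ext
  · simp only
    field_simp
  · simp only
    field_simp

end

/-! On the unit sphere the terms in α, β, γ vanish. With D = -B > 0 the remaining field conserves
x^C y^D z^A, since C(log x)' + D(log y)' + A(log z)' = 0. On the open positive octant this monomial
is positive, vanishes at the boundary, and has a single critical point, its maximum, which is the
point to be studied. The other level sets in the octant are therefore closed orbits around it: the
point is a center for every A > 0, and the focus alternative never occurs.

To make this precise, put x/z = √(C/A) e^X and y/z = √(D/A) e^Y. The octant becomes the whole (X,
Y)-plane and the singular point the origin. Minus the logarithm of the monomial becomes, up to a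
constant, K = (A+C+D)/2 · log(A + C e^(2X) + D e^(2Y)) - CX - DY, and the field on the sphere
becomes the Hamiltonian field (K_Y, -K_X). The planar system differs from it by a positive factor.

Two properties of K carry the argument: it increases strictly along rays from 0
(`expPotential_radial_pos`) and it is proper (`tendsto_expPotential`). Its level curves are then
star-shaped closed curves, which `IsRadialPotential.exists_periodic_orbit` parametrizes by time;
`IsRadialPotential.isCenter` carries them to the (u, v)-plane. The eigenvalues come from a separate
computation: the Jacobian there is a nonzero antisymmetric matrix. -/

/-! ### Motion along a circle with positive speed -/

/-- The scalar equation `θ' = g θ`, for `g` continuous, positive and periodic, has a solution that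
is defined for all times, surjective, and periodic up to a translation by the period of `g`. -/
theorem exists_periodic_flow {g : ℝ → ℝ} (hg : Continuous g) (hpos : ∀ x, 0 < g x) {c : ℝ}
    (hc : 0 < c) (hper : Function.Periodic g c) :
    ∃ Θ : ℝ → ℝ, (∀ t, HasDerivAt Θ (g (Θ t)) t) ∧ Function.Surjective Θ ∧
      ∃ T, 0 < T ∧ ∀ t, Θ (t + T) = Θ t + c := by
  have hgi : Continuous fun x => (g x)⁻¹ := hg.inv₀ fun x => (hpos x).ne'
  have hint : ∀ a b : ℝ, IntervalIntegrable (fun x => (g x)⁻¹) MeasureTheory.volume a b :=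
    fun a b => hgi.intervalIntegrable a b
  have hperi : Function.Periodic (fun x => (g x)⁻¹) c := fun x => by simp only [hper x]
  -- Separation of variables: this is the time needed to reach the angle x from 0, and the solution
  -- is its inverse. It is onto because its integrand is periodic with positive integral over a
  -- period.
  let G : ℝ → ℝ := fun x => ∫ s in (0 : ℝ)..x, (g s)⁻¹
  have hG : ∀ x, HasDerivAt G (g x)⁻¹ x := fun x =>
    (hgi.integral_hasStrictDerivAt 0 x).hasDerivAt
  have hGmono : StrictMono G := strictMono_of_hasDerivAt_pos hG fun x => inv_pos.2 (hpos x)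
  have hGc : Continuous G := continuous_iff_continuousAt.2 fun x => (hG x).continuousAt
  have hGpos : 0 < ∫ s in (0 : ℝ)..c, (g s)⁻¹ := by
    have h := hGmono hc
    simpa [G] using h
  have hsurj : Function.Surjective G := hGc.surjective
    (hperi.tendsto_atTop_intervalIntegral_of_pos hGpos hc)
    (hperi.tendsto_atBot_intervalIntegral_of_pos hGpos hc)
  have hshift : ∀ x, G (x + c) = G x + G c := fun x => by
    have h := hperi.intervalIntegral_add_eq 0 x
    have h2 := intervalIntegral.integral_add_adjacent_intervals (hint 0 x) (hint x (x + c))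
    simp only [G, zero_add] at h h2 ⊢
    linarith
  let e : ℝ ≃o ℝ := hGmono.orderIsoOfSurjective G hsurj
  have he : ∀ x, G (e.symm x) = x := fun x => e.apply_symm_apply x
  refine ⟨e.symm, fun t => ?_, e.symm.surjective, G c, hGpos, fun t => ?_⟩
  · have h := HasDerivAt.of_local_left_inverse (e.symm.continuous.continuousAt (x := t))
      (hG (e.symm t)) (inv_pos.2 (hpos _)).ne' (Eventually.of_forall he)
    simpa using h
  · apply hGmono.injective
    rw [hshift, he, he]

/-! ### Proper, radially increasing Hamiltonians and their periodic orbits -/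

/-- A function on the plane with partial derivatives `KX`, `KY` that tends to infinity at infinity
and strictly increases along each ray from the origin. -/
structure IsRadialPotential (K KX KY : ℝ × ℝ → ℝ) : Prop where
  hasStrictFDerivAt : ∀ w, HasStrictFDerivAt K
    (KX w • ContinuousLinearMap.fst ℝ ℝ ℝ + KY w • ContinuousLinearMap.snd ℝ ℝ ℝ) w
  continuous_fst : Continuous KX
  continuous_snd : Continuous KY
  radial_pos : ∀ w, w ≠ 0 → 0 < w.1 * KX w + w.2 * KY w
  tendsto : Tendsto K (cocompact (ℝ × ℝ)) atTop

/-- The point with polar coordinates `r`, `θ`, the angle being measured clockwise from the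
second axis. -/
noncomputable def polarPoint (r θ : ℝ) : ℝ × ℝ := (r * Real.sin θ, r * Real.cos θ)

theorem polarPoint_ne_zero {r : ℝ} (hr : r ≠ 0) (θ : ℝ) : polarPoint r θ ≠ 0 := by
  intro h
  have h1 : r * Real.sin θ = 0 := congrArg Prod.fst h
  have h2 : r * Real.cos θ = 0 := congrArg Prod.snd h
  have h3 := Real.sin_sq_add_cos_sq θ
  rw [(mul_eq_zero.1 h1).resolve_left hr, (mul_eq_zero.1 h2).resolve_left hr] at h3
  norm_num at h3

theorem polarPoint_eq_smul (r θ : ℝ) : polarPoint r θ = r • polarPoint 1 θ := by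
  simp [polarPoint]

theorem polarPoint_add_two_pi (r θ : ℝ) : polarPoint r (θ + 2 * Real.pi) = polarPoint r θ := by
  simp [polarPoint]

theorem exists_polarPoint {w : ℝ × ℝ} (hw : w ≠ 0) : ∃ r θ, 0 < r ∧ w = polarPoint r θ := by
  -- The coordinates are swapped because the angle is measured from the second axis.
  have hz : (⟨w.2, w.1⟩ : ℂ) ≠ 0 := by
    intro h
    exact hw (Prod.ext (congrArg Complex.im h) (congrArg Complex.re h))
  refine ⟨‖(⟨w.2, w.1⟩ : ℂ)‖, Complex.arg ⟨w.2, w.1⟩, norm_pos_iff.2 hz, ?_⟩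
  simp only [polarPoint, Complex.norm_mul_sin_arg, Complex.norm_mul_cos_arg]

theorem continuous_polarPoint : Continuous fun q : ℝ × ℝ => polarPoint q.1 q.2 := by
  unfold polarPoint
  fun_prop

namespace IsRadialPotential

variable {K KX KY : ℝ × ℝ → ℝ}

theorem continuous (hK : IsRadialPotential K KX KY) : Continuous K :=
  continuous_iff_continuousAt.2 fun w => (hK.hasStrictFDerivAt w).continuousAt

theorem hasDerivAt_comp (hK : IsRadialPotential K KX KY) {c : ℝ → ℝ × ℝ} {c' : ℝ × ℝ} {t : ℝ}
    (hc : HasDerivAt c c' t) :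
    HasDerivAt (fun s => K (c s)) (KX (c t) * c'.1 + KY (c t) * c'.2) t := by
  have h := (hK.hasStrictFDerivAt (c t)).hasFDerivAt.comp_hasDerivAt t hc
  simp only [add_apply, smul_apply, ContinuousLinearMap.coe_fst', ContinuousLinearMap.coe_snd',
    smul_eq_mul] at h
  exact h

theorem strictMonoOn_ray (hK : IsRadialPotential K KX KY) {w : ℝ × ℝ} (hw : w ≠ 0) :
    StrictMonoOn (fun r : ℝ => K (r • w)) (Set.Ici 0) := by
  have hd : ∀ r : ℝ, HasDerivAt (fun r : ℝ => r • w) w r := fun r => by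
    simpa using (hasDerivAt_id r).smul_const w
  refine strictMonoOn_of_hasDerivWithinAt_pos (convex_Ici 0)
    (hK.continuous.comp (by fun_prop)).continuousOn
    (fun r _ => (hK.hasDerivAt_comp (hd r)).hasDerivWithinAt) fun r hr => ?_
  rw [interior_Ici] at hr
  have hr : 0 < r := hr
  have h := hK.radial_pos (r • w) (smul_ne_zero hr.ne' hw)
  simp only [Prod.smul_fst, Prod.smul_snd, smul_eq_mul] at h
  have h2 : 0 < r * (KX (r • w) * w.1 + KY (r • w) * w.2) := by linarith
  exact pos_of_mul_pos_right h2 hr.le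

theorem apply_zero_lt (hK : IsRadialPotential K KX KY) {w : ℝ × ℝ} (hw : w ≠ 0) : K 0 < K w := by
  have h := hK.strictMonoOn_ray hw Set.self_mem_Ici (zero_le_one' ℝ) one_pos
  simp only [zero_smul, one_smul] at h
  exact h

theorem exists_radius (hK : IsRadialPotential K KX KY) {h : ℝ} (hh : K 0 < h) (θ : ℝ) :
    ∃ r, 0 < r ∧ K (polarPoint r θ) = h := by
  have hne : polarPoint 1 θ ≠ 0 := polarPoint_ne_zero one_ne_zero θ
  have ht : Tendsto (fun r : ℝ => K (polarPoint r θ)) atTop atTop := by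
    refine hK.tendsto.comp (tendsto_norm_atTop_iff_cobounded.1 ?_ |>.mono_right
      Metric.cobounded_le_cocompact)
    have hn : ∀ r : ℝ, ‖polarPoint r θ‖ = ‖r‖ * ‖polarPoint 1 θ‖ := fun r => by
      rw [polarPoint_eq_smul, norm_smul]
    refine Tendsto.congr (fun r => (hn r).symm) ?_
    exact tendsto_norm_atTop_atTop.atTop_mul_const (norm_pos_iff.2 hne)
  obtain ⟨b, hb, hb0⟩ := ((ht.eventually_gt_atTop h).and (eventually_gt_atTop 0)).exists
  have hcont : Continuous fun r : ℝ => K (polarPoint r θ) :=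
    hK.continuous.comp (continuous_polarPoint.comp (by fun_prop : Continuous fun r : ℝ => (r, θ)))
  have h0 : K (polarPoint 0 θ) < h := by
    rw [polarPoint_eq_smul, zero_smul]
    exact hh
  obtain ⟨r, hr, hr'⟩ := intermediate_value_Ioo hb0.le hcont.continuousOn ⟨h0, hb⟩
  exact ⟨r, hr.1, hr'⟩

theorem radius_unique (hK : IsRadialPotential K KX KY) {r s θ : ℝ} (hr : 0 < r) (hs : 0 < s)
    (h : K (polarPoint r θ) = K (polarPoint s θ)) : r = s := by
  rw [polarPoint_eq_smul r, polarPoint_eq_smul s] at h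
  exact (hK.strictMonoOn_ray (polarPoint_ne_zero one_ne_zero θ)).injOn hr.le hs.le h

/-- The level sets of a radial potential are differentiable curves in polar coordinates. -/
theorem exists_radius_function (hK : IsRadialPotential K KX KY) {h : ℝ} (hh : K 0 < h) :
    ∃ ρ : ℝ → ℝ, Differentiable ℝ ρ ∧ Function.Periodic ρ (2 * Real.pi) ∧ (∀ θ, 0 < ρ θ) ∧
      ∀ θ, K (polarPoint (ρ θ) θ) = h := by
  choose ρ hρ hρK using hK.exists_radius hh
  refine ⟨ρ, fun θ => ?_, fun θ => ?_, hρ, hρK⟩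
  · let F : ℝ × ℝ → ℝ := fun q => K (polarPoint q.2 q.1)
    set w := polarPoint (ρ θ) θ with hw
    have hp : HasStrictFDerivAt (fun q : ℝ × ℝ => polarPoint q.2 q.1)
        (fderiv ℝ (fun q : ℝ × ℝ => polarPoint q.2 q.1) (θ, ρ θ)) (θ, ρ θ) := by
      have : ContDiff ℝ 1 (fun q : ℝ × ℝ => polarPoint q.2 q.1) := by
        unfold polarPoint
        fun_prop
      exact this.contDiffAt.hasStrictFDerivAt one_ne_zero
    have hF := (hK.hasStrictFDerivAt w).comp (θ, ρ θ) hp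
    set L := (KX w • ContinuousLinearMap.fst ℝ ℝ ℝ + KY w • ContinuousLinearMap.snd ℝ ℝ ℝ).comp
      (fderiv ℝ (fun q : ℝ × ℝ => polarPoint q.2 q.1) (θ, ρ θ)) with hL
    have hL1 : L (0, 1) = KX w * Real.sin θ + KY w * Real.cos θ := by
      have h1 : HasDerivAt (fun r : ℝ => ((θ, r) : ℝ × ℝ)) (0, 1) (ρ θ) :=
        (hasDerivAt_const _ _).prodMk (hasDerivAt_id _)
      have h2 := hF.hasFDerivAt.comp_hasDerivAt (ρ θ) h1
      have h3 : HasDerivAt (fun r : ℝ => polarPoint r θ) (Real.sin θ, Real.cos θ) (ρ θ) := by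
        simpa [polarPoint] using
          ((hasDerivAt_id (ρ θ)).mul_const (Real.sin θ)).prodMk
            ((hasDerivAt_id (ρ θ)).mul_const (Real.cos θ))
      exact h2.unique (hK.hasDerivAt_comp h3)
    have hL1pos : L (0, 1) ≠ 0 := by
      have h1 := hK.radial_pos w (polarPoint_ne_zero (hρ θ).ne' θ)
      have h2 : 0 < ρ θ * L (0, 1) := by
        rw [hL1]
        simp only [hw, polarPoint] at h1 ⊢
        linarith
      exact (pos_of_mul_pos_right h2 (hρ θ).le).ne'
    -- The implicit function theorem applies because the radial derivative is nonzero. The radius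
    -- was chosen separately for each angle; by uniqueness on rays it agrees locally with the
    -- implicit function, as soon as the latter is positive.
    have hinv : (L ∘L .inr ℝ ℝ ℝ).IsInvertible := by
      refine ⟨ContinuousLinearEquiv.unitsEquivAut ℝ (Units.mk0 _ hL1pos), ?_⟩
      ext
      simp
    have hψ := hF.hasStrictFDerivAt_implicitFunctionOfProdDomain hinv
    have hev := hF.eventually_apply_implicitFunctionOfProdDomain hinv
    have htend := hF.tendsto_implicitFunctionOfProdDomain hinv
    refine hψ.hasFDerivAt.differentiableAt.congr_of_eventuallyEq ?_
    filter_upwards [hev, htend.eventually (lt_mem_nhds (hρ θ))] with x hx hx0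
    refine hK.radius_unique (θ := x) (hρ x) hx0 ?_
    rw [hρK x]
    exact ((hρK θ).symm.trans hx.symm)
  · refine hK.radius_unique (θ := θ) (hρ _) (hρ θ) ?_
    rw [hρK θ, ← polarPoint_add_two_pi]
    exact hρK _

theorem isCompact_sublevel (hK : IsRadialPotential K KX KY) (h : ℝ) : IsCompact {w | K w ≤ h} := by
  have h1 := hK.tendsto.eventually_gt_atTop h
  obtain ⟨t, ht, hts⟩ := mem_cocompact.1 h1
  refine ht.of_isClosed_subset (isClosed_le hK.continuous continuous_const) fun w hw => ?_
  by_contra hwt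
  exact not_lt.2 (show K w ≤ h from hw) (hts hwt)

/-- The nonzero orbits of a Hamiltonian system with a radial Hamiltonian, up to a positive factor,
are periodic and fill the level sets. -/
theorem exists_periodic_orbit (hK : IsRadialPotential K KX KY) {lam : ℝ × ℝ → ℝ}
    (hlam : Continuous lam) (hlampos : ∀ w, 0 < lam w) {w₀ : ℝ × ℝ} (hw₀ : w₀ ≠ 0) :
    ∃ c : ℝ → ℝ × ℝ, c 0 = w₀ ∧
      (∀ t, HasDerivAt c (lam (c t) * KY (c t), -(lam (c t) * KX (c t))) t) ∧
      (∃ T, 0 < T ∧ Function.Periodic c T) ∧ Set.range c = {w | K w = K w₀} := by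
  have hh := hK.apply_zero_lt hw₀
  obtain ⟨ρ, hρd, hρper, hρ, hρK⟩ := hK.exists_radius_function hh
  let b : ℝ → ℝ × ℝ := fun θ => polarPoint (ρ θ) θ
  have hbne : ∀ θ, b θ ≠ 0 := fun θ => polarPoint_ne_zero (hρ θ).ne' θ
  have hbc : Continuous b := continuous_polarPoint.comp (hρd.continuous.prodMk continuous_id)
  have hbper : Function.Periodic b (2 * Real.pi) := fun θ => by
    simp only [b, polarPoint_add_two_pi, hρper θ]
  let b' : ℝ → ℝ × ℝ := fun θ => (deriv ρ θ * Real.sin θ + ρ θ * Real.cos θ,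
    deriv ρ θ * Real.cos θ + ρ θ * -Real.sin θ)
  have hb' : ∀ θ, HasDerivAt b (b' θ) θ := fun θ =>
    ((hρd θ).hasDerivAt.mul (Real.hasDerivAt_sin θ)).prodMk
      ((hρd θ).hasDerivAt.mul (Real.hasDerivAt_cos θ))
  have htan : ∀ θ, KX (b θ) * (b' θ).1 + KY (b θ) * (b' θ).2 = 0 := fun θ => by
    have h1 := hK.hasDerivAt_comp (hb' θ)
    have h2 : (fun s => K (b s)) = fun _ => K w₀ := funext hρK
    rw [h2] at h1
    exact h1.unique (hasDerivAt_const θ _)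
  have hcross : ∀ θ, (b θ).2 * (b' θ).1 - (b θ).1 * (b' θ).2 = ρ θ ^ 2 := fun θ => by
    simp only [b, b', polarPoint]
    linear_combination ρ θ ^ 2 * Real.sin_sq_add_cos_sq θ
  -- The angular speed (y x' - x y') / r² of the Hamiltonian flow. It is positive by radial
  -- monotonicity, so the flow turns clockwise, the direction of increasing θ.
  let g : ℝ → ℝ := fun θ =>
    lam (b θ) * ((b θ).1 * KX (b θ) + (b θ).2 * KY (b θ)) / ρ θ ^ 2
  have hgc : Continuous g := by
    have h1 := hK.continuous_fst
    have h2 := hK.continuous_snd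
    have h3 := hρd.continuous
    exact Continuous.div (by fun_prop) (by fun_prop) fun θ => (pow_pos (hρ θ) 2).ne'
  have hgpos : ∀ θ, 0 < g θ := fun θ =>
    div_pos (mul_pos (hlampos _) (hK.radial_pos _ (hbne θ))) (pow_pos (hρ θ) 2)
  have hgper : Function.Periodic g (2 * Real.pi) := fun θ => by
    simp only [g, hbper θ, hρper θ]
  obtain ⟨Θ, hΘ, hΘs, T, hT, hΘT⟩ := exists_periodic_flow hgc hgpos Real.two_pi_pos hgper
  have hbrange : Set.range b = {w | K w = K w₀} := by
    ext w
    constructor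
    · rintro ⟨θ, rfl⟩
      exact hρK θ
    · intro hw
      have hw : K w = K w₀ := hw
      have hwne : w ≠ 0 := by
        rintro rfl
        exact hh.ne hw
      obtain ⟨r, θ, hr, rfl⟩ := exists_polarPoint hwne
      refine ⟨θ, ?_⟩
      simp only [b]
      rw [hK.radius_unique (hρ θ) hr ((hρK θ).trans hw.symm)]
  have hw₀mem : w₀ ∈ Set.range b := hbrange ▸ rfl
  obtain ⟨θ₀, hθ₀⟩ := hw₀mem
  obtain ⟨t₀, ht₀⟩ := hΘs θ₀
  refine ⟨fun t => b (Θ (t + t₀)), by simp only [zero_add, ht₀, hθ₀], fun t => ?_,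
    ⟨T, hT, fun t => ?_⟩, ?_⟩
  · have h1 := (hb' (Θ (t + t₀))).scomp t ((hΘ (t + t₀)).comp_add_const t t₀)
    refine h1.congr_deriv ?_
    set θ := Θ (t + t₀)
    have e1 := htan θ
    have e2 := hcross θ
    have e3 : ρ θ ^ 2 ≠ 0 := (pow_pos (hρ θ) 2).ne'
    ext
    · simp only [Prod.smul_fst, smul_eq_mul, g]
      rw [div_mul_eq_mul_div, div_eq_iff e3]
      linear_combination lam (b θ) * KY (b θ) * e2 + lam (b θ) * (b θ).1 * e1
    · simp only [Prod.smul_snd, smul_eq_mul, g]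
      rw [div_mul_eq_mul_div, div_eq_iff e3]
      linear_combination -lam (b θ) * KX (b θ) * e2 + lam (b θ) * (b θ).2 * e1
  · have h1 : t + T + t₀ = t + t₀ + T := by ring
    simp only [h1, hΘT, hbper (Θ (t + t₀))]
  · rw [← hbrange]
    exact ((hΘs.comp (Equiv.addRight t₀).surjective).range_comp b)

end IsRadialPotential

/-! ### Transport of the periodic orbits to a center -/

/-- A center, obtained by transporting a Hamiltonian system with a radial Hamiltonian along a
homeomorphism of the plane onto a bounded open set. -/
theorem IsRadialPotential.isCenter {K KX KY lam : ℝ × ℝ → ℝ} (hK : IsRadialPotential K KX KY)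
    (hlam : Continuous lam) (hlampos : ∀ w, 0 < lam w) {f Φ Ψ : ℝ × ℝ → ℝ × ℝ} {Ω : Set (ℝ × ℝ)}
    (hΩ : IsOpen Ω) (hΩb : Bornology.IsBounded Ω) (hΦ : Continuous Φ) (hmaps : ∀ w, Φ w ∈ Ω)
    (hΨ : ContinuousOn Ψ Ω) (hleft : ∀ w, Ψ (Φ w) = w) (hright : ∀ q ∈ Ω, Φ (Ψ q) = q)
    (hconj : ∀ (c : ℝ → ℝ × ℝ) (t : ℝ),
      HasDerivAt c (lam (c t) * KY (c t), -(lam (c t) * KX (c t))) t →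
      HasDerivAt (fun s => Φ (c s)) (f (Φ (c t))) t)
    (hf : f (Φ 0) = 0) : IsCenter f (Φ 0) := by
  refine ⟨hf, ?_⟩
  filter_upwards [self_mem_nhdsWithin, mem_nhdsWithin_of_mem_nhds (hΩ.mem_nhds (hmaps 0))]
    with q hq hqΩ
  have hw₀ : Ψ q ≠ 0 := fun h => hq (by
    have h1 := hright q hqΩ
    rw [h] at h1
    exact h1.symm)
  have hh := hK.apply_zero_lt hw₀
  obtain ⟨c, hc0, hc, ⟨T, hT, hcT⟩, hcr⟩ := hK.exists_periodic_orbit hlam hlampos hw₀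
  refine ⟨fun t => Φ (c t), fun t => hconj c t (hc t), by simp only [hc0, hright q hqΩ],
    ⟨T, hT, fun t => by simp only [hcT t]⟩, ?_, ?_⟩
  · rintro ⟨t, ht⟩
    have h1 : c t = 0 := by
      rw [← hleft (c t), ← hleft 0]
      exact congrArg Ψ ht
    have h2 : c t ∈ {w | K w = K (Ψ q)} := hcr ▸ Set.mem_range_self t
    have h2 : K (c t) = K (Ψ q) := h2
    rw [h1] at h2
    exact hh.ne h2
  · set R := Set.range fun t => Φ (c t)
    -- `connectedComponentIn` is empty by default when the point lies outside the set.
    by_cases hp : Φ 0 ∈ Rᶜ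
    swap
    · rw [connectedComponentIn_eq_empty hp]
      exact Bornology.isBounded_empty
    -- The open region inside the orbit. Its closure lies in the image of a compact sublevel set, so
    -- it stays in Ω and adds only points of the orbit. A connected set that avoids the orbit and
    -- meets the region therefore stays inside it.
    let S : Set (ℝ × ℝ) := Ω ∩ Ψ ⁻¹' {w | K w < K (Ψ q)}
    have hS : IsOpen S :=
      hΨ.isOpen_inter_preimage hΩ (isOpen_lt hK.continuous continuous_const)
    refine hΩb.subset (Set.Subset.trans ?_ (Set.inter_subset_left : S ⊆ Ω))
    refine isPreconnected_connectedComponentIn.subset_of_closure_inter_subset hS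
      ⟨Φ 0, mem_connectedComponentIn hp, hmaps 0, ?_⟩ ?_
    · show K (Ψ (Φ 0)) < K (Ψ q)
      rw [hleft]
      exact hh
    · rintro x ⟨hxS, hxR⟩
      have hxR : x ∉ R := connectedComponentIn_subset _ _ hxR
      have hcl : closure S ⊆ Φ '' {w | K w ≤ K (Ψ q)} :=
        closure_minimal (fun y hy => ⟨Ψ y, (show K (Ψ y) < K (Ψ q) from hy.2).le, hright y hy.1⟩)
          ((hK.isCompact_sublevel _).image hΦ).isClosed
      obtain ⟨w, hw, rfl⟩ := hcl hxS
      have hw : K w ≤ K (Ψ q) := hw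
      refine ⟨hmaps w, ?_⟩
      show K (Ψ (Φ w)) < K (Ψ q)
      rw [hleft]
      refine lt_of_le_of_ne hw fun h => hxR ?_
      have h1 : w ∈ Set.range c := hcr ▸ h
      obtain ⟨t, rfl⟩ := h1
      exact ⟨t, rfl⟩

/-! ### The first integral in logarithmic coordinates -/

section Potential

/-- `A + C e^(2X) + D e^(2Y)`. -/
noncomputable def expSum (A C D : ℝ) (w : ℝ × ℝ) : ℝ :=
  A + C * Real.exp w.1 ^ 2 + D * Real.exp w.2 ^ 2

/-- The Hamiltonian `(A + C + D) / 2 * log (A + C e^(2X) + D e^(2Y)) - C X - D Y`. -/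
noncomputable def expPotential (A C D : ℝ) (w : ℝ × ℝ) : ℝ :=
  (A + C + D) / 2 * Real.log (expSum A C D w) - C * w.1 - D * w.2

/-- The partial derivative of `expPotential` in the first variable. -/
noncomputable def expPotentialFst (A C D : ℝ) (w : ℝ × ℝ) : ℝ :=
  (A + C + D) * (C * Real.exp w.1 ^ 2) / expSum A C D w - C

/-- The partial derivative of `expPotential` in the second variable. -/
noncomputable def expPotentialSnd (A C D : ℝ) (w : ℝ × ℝ) : ℝ :=
  (A + C + D) * (D * Real.exp w.2 ^ 2) / expSum A C D w - D

variable {A C D : ℝ}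

theorem expSum_pos (hA : 0 < A) (hC : 0 < C) (hD : 0 < D) (w : ℝ × ℝ) : 0 < expSum A C D w := by
  unfold expSum
  positivity

theorem continuous_expSum : Continuous (expSum A C D) := by
  unfold expSum
  fun_prop

theorem hasStrictFDerivAt_expPotential (hA : 0 < A) (hC : 0 < C) (hD : 0 < D) (w : ℝ × ℝ) :
    HasStrictFDerivAt (expPotential A C D)
      (expPotentialFst A C D w • ContinuousLinearMap.fst ℝ ℝ ℝ +
        expPotentialSnd A C D w • ContinuousLinearMap.snd ℝ ℝ ℝ) w := by
  have hW := (expSum_pos hA hC hD w).ne'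
  have h1 : HasStrictFDerivAt (fun w : ℝ × ℝ => w.1) (ContinuousLinearMap.fst ℝ ℝ ℝ) w :=
    hasStrictFDerivAt_fst
  have h2 : HasStrictFDerivAt (fun w : ℝ × ℝ => w.2) (ContinuousLinearMap.snd ℝ ℝ ℝ) w :=
    hasStrictFDerivAt_snd
  have h3 : HasStrictFDerivAt (expSum A C D) _ w :=
    (((h1.exp.pow 2).const_mul C).const_add A).add ((h2.exp.pow 2).const_mul D)
  have h4 := (((h3.log hW).const_mul ((A + C + D) / 2)).sub (h1.const_mul C)).sub
    (h2.const_mul D)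
  refine h4.congr_fderiv ?_
  ext
  · simp [expPotentialFst]
    field_simp
  · simp [expPotentialSnd]
    field_simp

theorem mul_exp_sq_sub_nonneg (x y : ℝ) :
    0 ≤ (x - y) * (Real.exp x ^ 2 - Real.exp y ^ 2) := by
  rcases le_total x y with h | h
  · have h1 : Real.exp x ^ 2 ≤ Real.exp y ^ 2 := by gcongr
    exact mul_nonneg_of_nonpos_of_nonpos (by linarith) (by linarith)
  · have h1 : Real.exp y ^ 2 ≤ Real.exp x ^ 2 := by gcongr
    exact mul_nonneg (by linarith) (by linarith)

theorem mul_exp_sq_sub_one_pos {x : ℝ} (hx : x ≠ 0) : 0 < x * (Real.exp x ^ 2 - 1) := by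
  rcases hx.lt_or_gt with h | h
  · have h1 : Real.exp x ^ 2 < 1 :=
      pow_lt_one₀ (Real.exp_pos x).le (Real.exp_lt_one_iff.2 h) two_ne_zero
    exact mul_pos_of_neg_of_neg h (by linarith)
  · have h1 : 1 < Real.exp x ^ 2 := one_lt_pow₀ (Real.one_lt_exp_iff.2 h) two_ne_zero
    exact mul_pos h (by linarith)

/-- After multiplication by the exponential sum, the radial derivative is a positive combination of
X(e^(2X) - 1), Y(e^(2Y) - 1) and (X - Y)(e^(2X) - e^(2Y)), all nonnegative since exp is increasing.
-/
theorem expPotential_radial_pos (hA : 0 < A) (hC : 0 < C) (hD : 0 < D) {w : ℝ × ℝ} (hw : w ≠ 0) :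
    0 < w.1 * expPotentialFst A C D w + w.2 * expPotentialSnd A C D w := by
  have hW := expSum_pos hA hC hD w
  have key : w.1 * expPotentialFst A C D w + w.2 * expPotentialSnd A C D w =
      (A * C * (w.1 * (Real.exp w.1 ^ 2 - 1)) + A * D * (w.2 * (Real.exp w.2 ^ 2 - 1)) +
        C * D * ((w.1 - w.2) * (Real.exp w.1 ^ 2 - Real.exp w.2 ^ 2))) / expSum A C D w := by
    have h : expSum A C D w = A + C * Real.exp w.1 ^ 2 + D * Real.exp w.2 ^ 2 := rfl
    rw [expPotentialFst, expPotentialSnd, eq_div_iff hW.ne']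
    field_simp
    rw [h]
    ring
  rw [key]
  refine div_pos ?_ hW
  have h3 := mul_nonneg (mul_pos hC hD).le (mul_exp_sq_sub_nonneg w.1 w.2)
  have hx0 : 0 ≤ w.1 * (Real.exp w.1 ^ 2 - 1) := by
    simpa using mul_exp_sq_sub_nonneg w.1 0
  have hy0 : 0 ≤ w.2 * (Real.exp w.2 ^ 2 - 1) := by
    simpa using mul_exp_sq_sub_nonneg w.2 0
  have hx1 := mul_nonneg (mul_pos hA hC).le hx0
  have hy1 := mul_nonneg (mul_pos hA hD).le hy0
  by_cases hx : w.1 = 0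
  · have hy : w.2 ≠ 0 := fun hy => hw (Prod.ext hx hy)
    have := mul_pos (mul_pos hA hD) (mul_exp_sq_sub_one_pos hy)
    linarith
  · have := mul_pos (mul_pos hA hC) (mul_exp_sq_sub_one_pos hx)
    linarith

/-- With M = max(0, X, Y), the logarithm is at least 2M up to a constant, so K is bounded below by
AM + C(M - X) + D(M - Y) plus a constant. The three terms are nonnegative and together dominate a
multiple of the norm. -/
theorem tendsto_expPotential (hA : 0 < A) (hC : 0 < C) (hD : 0 < D) :
    Tendsto (expPotential A C D) (cocompact (ℝ × ℝ)) atTop := by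
  set κ := min A (min C D) with hκ
  have hκ0 : 0 < κ := lt_min hA (lt_min hC hD)
  have hκA : κ ≤ A := min_le_left _ _
  have hκC : κ ≤ C := (min_le_right _ _).trans (min_le_left _ _)
  have hκD : κ ≤ D := (min_le_right _ _).trans (min_le_right _ _)
  have hlog : ∀ (w : ℝ × ℝ) (m : ℝ), κ * Real.exp m ^ 2 ≤ expSum A C D w →
      Real.log κ + 2 * m ≤ Real.log (expSum A C D w) := fun w m h => by
    have h1 := Real.log_le_log (mul_pos hκ0 (pow_pos (Real.exp_pos m) 2)) h
    rwa [Real.log_mul hκ0.ne' (pow_pos (Real.exp_pos m) 2).ne', Real.log_pow, Real.log_exp] at h1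
  have hbound : ∀ w : ℝ × ℝ,
      κ * ‖w‖ + (A + C + D) / 2 * Real.log κ ≤ expPotential A C D w := fun w => by
    set M := max 0 (max w.1 w.2) with hM
    have hM0 : 0 ≤ M := le_max_left _ _
    have hM1 : w.1 ≤ M := (le_max_left _ _).trans (le_max_right _ _)
    have hM2 : w.2 ≤ M := (le_max_right _ _).trans (le_max_right _ _)
    have hx := mul_pos hC (pow_pos (Real.exp_pos w.1) 2)
    have hy := mul_pos hD (pow_pos (Real.exp_pos w.2) 2)
    have h1 : Real.log κ + 2 * M ≤ Real.log (expSum A C D w) := by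
      refine hlog w M ?_
      unfold expSum
      rcases max_choice 0 (max w.1 w.2) with h | h
      · rw [← hM] at h
        rw [h, Real.exp_zero]
        linarith
      · rcases max_choice w.1 w.2 with h' | h'
        · rw [hM, h, h']
          have := mul_le_mul_of_nonneg_right hκC (pow_pos (Real.exp_pos w.1) 2).le
          linarith
        · rw [hM, h, h']
          have := mul_le_mul_of_nonneg_right hκD (pow_pos (Real.exp_pos w.2) 2).le
          linarith
    have h2 : ‖w‖ ≤ M + (M - w.1) + (M - w.2) := by
      rw [Prod.norm_def, Real.norm_eq_abs, Real.norm_eq_abs]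
      refine max_le (abs_le.2 ⟨?_, ?_⟩) (abs_le.2 ⟨?_, ?_⟩) <;> linarith
    have h3 := mul_le_mul_of_nonneg_left h1 (by positivity : 0 ≤ (A + C + D) / 2)
    have h4 := mul_le_mul_of_nonneg_left h2 hκ0.le
    have h5 := mul_le_mul_of_nonneg_right hκA hM0
    have h6 := mul_le_mul_of_nonneg_right hκC (sub_nonneg.2 hM1)
    have h7 := mul_le_mul_of_nonneg_right hκD (sub_nonneg.2 hM2)
    unfold expPotential
    linarith
  refine tendsto_atTop_mono hbound (tendsto_atTop_add_const_right _ _ ?_)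
  exact (tendsto_norm_cocompact_atTop (E := ℝ × ℝ)).const_mul_atTop hκ0

theorem isRadialPotential_expPotential (hA : 0 < A) (hC : 0 < C) (hD : 0 < D) :
    IsRadialPotential (expPotential A C D) (expPotentialFst A C D) (expPotentialSnd A C D) where
  hasStrictFDerivAt := hasStrictFDerivAt_expPotential hA hC hD
  continuous_fst := ((by fun_prop : Continuous fun w : ℝ × ℝ =>
    (A + C + D) * (C * Real.exp w.1 ^ 2)).div continuous_expSum
      fun w => (expSum_pos hA hC hD w).ne').sub continuous_const
  continuous_snd := ((by fun_prop : Continuous fun w : ℝ × ℝ =>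
    (A + C + D) * (D * Real.exp w.2 ^ 2)).div continuous_expSum
      fun w => (expSum_pos hA hC hD w).ne').sub continuous_const
  radial_pos _ hw := expPotential_radial_pos hA hC hD hw
  tendsto := tendsto_expPotential hA hC hD

end Potential

/-! ### The chart of the positive quarter disk and the conjugacy -/

section Chart

/-- The logarithmic chart of the open positive quarter of the unit disk. -/
noncomputable def quarterChart (A C D : ℝ) (w : ℝ × ℝ) : ℝ × ℝ :=
  (√C * Real.exp w.1 / (√(expSum A C D w) + √A), √D * Real.exp w.2 / (√(expSum A C D w) + √A))

/-- The inverse of `quarterChart`. -/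
noncomputable def quarterChartInv (A C D : ℝ) (q : ℝ × ℝ) : ℝ × ℝ :=
  (Real.log (2 * √A * q.1 / (√C * (1 - q.1 ^ 2 - q.2 ^ 2))),
   Real.log (2 * √A * q.2 / (√D * (1 - q.1 ^ 2 - q.2 ^ 2))))

/-- The open positive quarter of the unit disk. -/
def quarterDisk : Set (ℝ × ℝ) := {q | 0 < q.1 ∧ 0 < q.2 ∧ 0 < 1 - q.1 ^ 2 - q.2 ^ 2}

theorem isOpen_quarterDisk : IsOpen quarterDisk :=
  (isOpen_lt continuous_const continuous_fst).inter
    ((isOpen_lt continuous_const continuous_snd).inter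
      (isOpen_lt continuous_const
        ((continuous_const.sub (continuous_fst.pow 2)).sub (continuous_snd.pow 2))))

theorem isBounded_quarterDisk : Bornology.IsBounded quarterDisk := by
  refine (Metric.isBounded_closedBall (x := (0 : ℝ × ℝ)) (r := 1)).subset fun q hq => ?_
  obtain ⟨h1, h2, h3⟩ := hq
  rw [mem_closedBall_zero_iff, Prod.norm_def, Real.norm_eq_abs, Real.norm_eq_abs]
  exact max_le ((sq_le_one_iff_abs_le_one _).1 (by nlinarith))
    ((sq_le_one_iff_abs_le_one _).1 (by nlinarith))

variable {A C D : ℝ}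

/-- With W the exponential sum, the chart is stereographic projection of the sphere point with z =
√(A/W), and 1 - u² - v² = 2z/(1 + z). -/
theorem one_sub_quarterChart (hA : 0 < A) (hC : 0 < C) (hD : 0 < D) (w : ℝ × ℝ) :
    1 - (quarterChart A C D w).1 ^ 2 - (quarterChart A C D w).2 ^ 2 =
      2 * √A / (√(expSum A C D w) + √A) := by
  have hs : 0 < √(expSum A C D w) := Real.sqrt_pos.2 (expSum_pos hA hC hD w)
  have ha : 0 < √A := Real.sqrt_pos.2 hA
  have e1 := Real.sq_sqrt (expSum_pos hA hC hD w).le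
  have e2 := Real.sq_sqrt hA.le
  have e3 := Real.sq_sqrt hC.le
  have e4 := Real.sq_sqrt hD.le
  have e5 : expSum A C D w = A + C * Real.exp w.1 ^ 2 + D * Real.exp w.2 ^ 2 := rfl
  simp only [quarterChart]
  set s := √(expSum A C D w)
  field_simp
  linear_combination e1 + e5 - e2 - Real.exp w.1 ^ 2 * e3 - Real.exp w.2 ^ 2 * e4

theorem quarterChart_mem (hA : 0 < A) (hC : 0 < C) (hD : 0 < D) (w : ℝ × ℝ) :
    quarterChart A C D w ∈ quarterDisk := by
  have hs : 0 < √(expSum A C D w) := Real.sqrt_pos.2 (expSum_pos hA hC hD w)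
  have ha : 0 < √A := Real.sqrt_pos.2 hA
  have hc : 0 < √C := Real.sqrt_pos.2 hC
  have hd : 0 < √D := Real.sqrt_pos.2 hD
  refine ⟨?_, ?_, ?_⟩
  · simp only [quarterChart]
    positivity
  · simp only [quarterChart]
    positivity
  · rw [one_sub_quarterChart hA hC hD]
    positivity

theorem continuous_quarterChart (hA : 0 < A) : Continuous (quarterChart A C D) := by
  have h : Continuous fun w => √(expSum A C D w) + √A :=
    (continuous_expSum.sqrt).add continuous_const
  have h0 : ∀ w, √(expSum A C D w) + √A ≠ 0 := fun w =>
    (add_pos_of_nonneg_of_pos (Real.sqrt_nonneg _) (Real.sqrt_pos.2 hA)).ne'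
  exact (Continuous.div (by fun_prop) h h0).prodMk (Continuous.div (by fun_prop) h h0)

theorem continuousOn_quarterChartInv (hA : 0 < A) (hC : 0 < C) (hD : 0 < D) :
    ContinuousOn (quarterChartInv A C D) quarterDisk := by
  have ha : 0 < √A := Real.sqrt_pos.2 hA
  have hc : 0 < √C := Real.sqrt_pos.2 hC
  have hd : 0 < √D := Real.sqrt_pos.2 hD
  refine ContinuousOn.prodMk ?_ ?_
  · refine ContinuousOn.log (ContinuousOn.div (by fun_prop) (by fun_prop) fun q hq => ?_)
      fun q hq => ?_
    · exact (mul_pos hc hq.2.2).ne'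
    · exact (div_pos (mul_pos (by positivity) hq.1) (mul_pos hc hq.2.2)).ne'
  · refine ContinuousOn.log (ContinuousOn.div (by fun_prop) (by fun_prop) fun q hq => ?_)
      fun q hq => ?_
    · exact (mul_pos hd hq.2.2).ne'
    · exact (div_pos (mul_pos (by positivity) hq.2.1) (mul_pos hd hq.2.2)).ne'

theorem quarterChartInv_quarterChart (hA : 0 < A) (hC : 0 < C) (hD : 0 < D) (w : ℝ × ℝ) :
    quarterChartInv A C D (quarterChart A C D w) = w := by
  have hs : 0 < √(expSum A C D w) := Real.sqrt_pos.2 (expSum_pos hA hC hD w)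
  have ha : 0 < √A := Real.sqrt_pos.2 hA
  have hc : 0 < √C := Real.sqrt_pos.2 hC
  have hd : 0 < √D := Real.sqrt_pos.2 hD
  rw [quarterChartInv, one_sub_quarterChart hA hC hD]
  simp only [quarterChart]
  refine Prod.ext ?_ ?_
  · refine Eq.trans (congrArg Real.log ?_) (Real.log_exp w.1)
    field_simp
  · refine Eq.trans (congrArg Real.log ?_) (Real.log_exp w.2)
    field_simp

theorem quarterChart_quarterChartInv (hA : 0 < A) (hC : 0 < C) (hD : 0 < D) {q : ℝ × ℝ}
    (hq : q ∈ quarterDisk) : quarterChart A C D (quarterChartInv A C D q) = q := by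
  have ha : 0 < √A := Real.sqrt_pos.2 hA
  have hc : 0 < √C := Real.sqrt_pos.2 hC
  have hd : 0 < √D := Real.sqrt_pos.2 hD
  obtain ⟨h1, h2, h3⟩ := hq
  have e2 := Real.sq_sqrt hA.le
  have e3 := Real.sq_sqrt hC.le
  have e4 := Real.sq_sqrt hD.le
  have hx : Real.exp (quarterChartInv A C D q).1 =
      2 * √A * q.1 / (√C * (1 - q.1 ^ 2 - q.2 ^ 2)) := Real.exp_log (by positivity)
  have hy : Real.exp (quarterChartInv A C D q).2 =
      2 * √A * q.2 / (√D * (1 - q.1 ^ 2 - q.2 ^ 2)) := Real.exp_log (by positivity)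
  -- This is √A / z, with z = (1 - u² - v²)/(1 + u² + v²).
  have hW : √(expSum A C D (quarterChartInv A C D q)) =
      √A * (1 + q.1 ^ 2 + q.2 ^ 2) / (1 - q.1 ^ 2 - q.2 ^ 2) := by
    rw [Real.sqrt_eq_iff_mul_self_eq (expSum_pos hA hC hD _).le (by positivity), ← pow_two]
    rw [expSum, hx, hy]
    simp only [div_pow, mul_pow, e2, e3, e4]
    field_simp
    ring
  have hsum : √A * (1 + q.1 ^ 2 + q.2 ^ 2) / (1 - q.1 ^ 2 - q.2 ^ 2) + √A =
      2 * √A / (1 - q.1 ^ 2 - q.2 ^ 2) := by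
    field_simp
    ring
  rw [quarterChart, hW, hx, hy, hsum]
  refine Prod.ext ?_ ?_
  · simp only
    field_simp
  · simp only
    field_simp

/-- The time change between the Hamiltonian system and the planar Kolmogorov system. -/
noncomputable def timeChange (A C D : ℝ) (w : ℝ × ℝ) : ℝ :=
  8 * expSum A C D w / (√(expSum A C D w) + √A) ^ 2

theorem timeChange_pos (hA : 0 < A) (hC : 0 < C) (hD : 0 < D) (w : ℝ × ℝ) :
    0 < timeChange A C D w := by
  have := expSum_pos hA hC hD w
  unfold timeChange
  positivity

theorem continuous_timeChange (hA : 0 < A) : Continuous (timeChange A C D) :=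
  (continuous_const.mul continuous_expSum).div
    (((continuous_expSum.sqrt).add continuous_const).pow 2) fun w => by
      have := Real.sqrt_pos.2 hA
      positivity

/-- On the sphere X' = x'/x - z'/z = (A + C + D)y² - D = K_Y, and likewise Y' = -K_X. Passing to the
polynomial planar system multiplies the speed by 2(1 + u² + v²)², which is the time change. -/
theorem hasDerivAt_quarterChart (hA : 0 < A) (hC : 0 < C) (hD : 0 < D) (α β γ : ℝ)
    (c : ℝ → ℝ × ℝ) (t : ℝ)
    (hc : HasDerivAt c (timeChange A C D (c t) * expPotentialSnd A C D (c t),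
      -(timeChange A C D (c t) * expPotentialFst A C D (c t))) t) :
    HasDerivAt (fun s => quarterChart A C D (c s))
      (projectedKolmogorov α β γ A (-D) C (quarterChart A C D (c t))) t := by
  have hW := expSum_pos hA hC hD (c t)
  have hs : 0 < √(expSum A C D (c t)) := Real.sqrt_pos.2 hW
  have ha : 0 < √A := Real.sqrt_pos.2 hA
  have e1 := Real.sq_sqrt hW.le
  have e2 := Real.sq_sqrt hA.le
  have e5 : expSum A C D (c t) = A + C * Real.exp (c t).1 ^ 2 + D * Real.exp (c t).2 ^ 2 := rfl
  have hd := one_sub_quarterChart hA hC hD (c t)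
  have hx : HasDerivAt (fun s => (c s).1) _ t := hc.fst
  have hy : HasDerivAt (fun s => (c s).2) _ t := hc.snd
  have hsum : HasDerivAt (fun s => expSum A C D (c s)) _ t :=
    (((hx.exp.pow 2).const_mul C).const_add A).add ((hy.exp.pow 2).const_mul D)
  have hden := (hsum.sqrt hW.ne').add_const (√A)
  have hne : √(expSum A C D (c t)) + √A ≠ 0 := by positivity
  have h := ((hx.exp.const_mul (√C)).div hden hne).prodMk ((hy.exp.const_mul (√D)).div hden hne)
  refine h.congr_deriv ?_
  have happ := projectedKolmogorov_apply α β γ A (-D) C (quarterChart A C D (c t)).1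
    (quarterChart A C D (c t)).2
  rw [hd] at happ
  rw [show projectedKolmogorov α β γ A (-D) C (quarterChart A C D (c t)) = _ from happ]
  simp only [quarterChart, timeChange, expPotentialFst, expPotentialSnd, Nat.cast_ofNat,
    Nat.reduceSub, pow_one]
  have e3 := Real.sq_sqrt hC.le
  have e4 := Real.sq_sqrt hD.le
  -- With the square roots and exponentials as free variables, the claim is a rational identity
  -- modulo the single relation s² = a² + k²E² + d²G².
  clear h hden hsum hx hy happ hd hc hW hne
  generalize √(expSum A C D (c t)) = s at *
  generalize expSum A C D (c t) = W at *
  generalize √A = a at *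
  generalize √C = k at *
  generalize √D = d at *
  generalize Real.exp (c t).1 = E at *
  generalize Real.exp (c t).2 = G at *
  subst e1 e2 e3 e4
  refine Prod.ext ?_ ?_
  · simp only
    field_simp
    linear_combination (-8 * k * E * d ^ 2 * s * (s + a)) * e5
  · simp only
    field_simp
    linear_combination (8 * d * G * k ^ 2 * s * (s + a)) * e5

end Chart

/-! ### The Jacobian and its eigenvalues -/

section Jacobian

theorem projectedKolmogorov_eq_zero {α β γ A B C u v : ℝ}
    (h1 : 4 * A * v ^ 2 + B * (1 - u ^ 2 - v ^ 2) ^ 2 = 0) (h2 : B * u ^ 2 + C * v ^ 2 = 0)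
    (h3 : -4 * A * u ^ 2 + C * (1 - u ^ 2 - v ^ 2) ^ 2 = 0) :
    projectedKolmogorov α β γ A B C (u, v) = 0 := by
  rw [projectedKolmogorov_apply, h1, h2, h3]
  simp

/-- The three equations say that the cofactors of x, y, z in the Kolmogorov field vanish at the
point. Modulo them the diagonal vanishes and the off-diagonal entries become opposite. -/
theorem planarJacobian_projectedKolmogorov {α β γ A B C u v : ℝ}
    (h1 : 4 * A * v ^ 2 + B * (1 - u ^ 2 - v ^ 2) ^ 2 = 0) (h2 : B * u ^ 2 + C * v ^ 2 = 0)
    (h3 : -4 * A * u ^ 2 + C * (1 - u ^ 2 - v ^ 2) ^ 2 = 0) :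
    planarJacobian (projectedKolmogorov α β γ A B C) (u, v) =
      !![0, 8 * u * v * (2 * A + (C - B) * (1 - u ^ 2 - v ^ 2));
        -(8 * u * v * (2 * A + (C - B) * (1 - u ^ 2 - v ^ 2))), 0] := by
  have hu : HasDerivAt (fun x : ℝ => 1 - x ^ 2 - v ^ 2) (-(2 * u)) u := by
    simpa using ((hasDerivAt_pow 2 u).const_sub 1).sub_const (v ^ 2)
  have hv : HasDerivAt (fun y : ℝ => 1 - u ^ 2 - y ^ 2) (-(2 * v)) v := by
    simpa using (hasDerivAt_pow 2 v).const_sub (1 - u ^ 2)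
  have hR1 : HasDerivAt (fun x : ℝ => -4 * (1 - x ^ 2 - v ^ 2) * (B * x ^ 2 + C * v ^ 2)) _ u :=
    (hu.const_mul (-4)).mul (((hasDerivAt_pow 2 u).const_mul B).add_const (C * v ^ 2))
  have hR2 : HasDerivAt (fun y : ℝ => -4 * (1 - u ^ 2 - y ^ 2) * (B * u ^ 2 + C * y ^ 2)) _ v :=
    (hv.const_mul (-4)).mul (((hasDerivAt_pow 2 v).const_mul C).const_add (B * u ^ 2))
  have h11 : HasDerivAt (fun x : ℝ => 2 * x * (4 * A * v ^ 2 + B * (1 - x ^ 2 - v ^ 2) ^ 2)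
      - x * (-4 * (1 - x ^ 2 - v ^ 2) * (B * x ^ 2 + C * v ^ 2))) _ u :=
    (((hasDerivAt_id' u).const_mul 2).mul
      (((hu.pow 2).const_mul B).const_add (4 * A * v ^ 2))).sub ((hasDerivAt_id' u).mul hR1)
  have h12 : HasDerivAt (fun y : ℝ => 2 * u * (4 * A * y ^ 2 + B * (1 - u ^ 2 - y ^ 2) ^ 2)
      - u * (-4 * (1 - u ^ 2 - y ^ 2) * (B * u ^ 2 + C * y ^ 2))) _ v :=
    ((((hasDerivAt_pow 2 v).const_mul (4 * A)).add ((hv.pow 2).const_mul B)).const_mul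
      (2 * u)).sub (hR2.const_mul u)
  have h21 : HasDerivAt (fun x : ℝ => 2 * v * (-4 * A * x ^ 2 + C * (1 - x ^ 2 - v ^ 2) ^ 2)
      - v * (-4 * (1 - x ^ 2 - v ^ 2) * (B * x ^ 2 + C * v ^ 2))) _ u :=
    ((((hasDerivAt_pow 2 u).const_mul (-4 * A)).add ((hu.pow 2).const_mul C)).const_mul
      (2 * v)).sub (hR1.const_mul v)
  have h22 : HasDerivAt (fun y : ℝ => 2 * y * (-4 * A * u ^ 2 + C * (1 - u ^ 2 - y ^ 2) ^ 2)
      - y * (-4 * (1 - u ^ 2 - y ^ 2) * (B * u ^ 2 + C * y ^ 2))) _ v :=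
    (((hasDerivAt_id' v).const_mul 2).mul
      (((hv.pow 2).const_mul C).const_add (-4 * A * u ^ 2))).sub ((hasDerivAt_id' v).mul hR2)
  simp only [planarJacobian, projectedKolmogorov_apply]
  rw [h11.deriv, h12.deriv, h21.deriv, h22.deriv]
  simp only [Nat.cast_ofNat, Nat.reduceSub, pow_one]
  congr 1
  ext i j
  fin_cases i <;> fin_cases j <;> simp
  · linear_combination 2 * h1 + (4 * (1 - u ^ 2 - v ^ 2) - 8 * u ^ 2) * h2
  · linear_combination (-8 * u * v) * h2
  · linear_combination (-8 * u * v) * h2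
  · linear_combination 2 * h3 + (4 * (1 - u ^ 2 - v ^ 2) - 8 * v ^ 2) * h2

theorem spectrum_skew (k : ℝ) :
    spectrum ℂ ((!![0, k; -k, 0] : Matrix (Fin 2) (Fin 2) ℝ).map Complex.ofReal) =
      {((0 : ℝ) : ℂ) + k * Complex.I, ((0 : ℝ) : ℂ) - k * Complex.I} := by
  ext z
  rw [spectrum.mem_iff, Matrix.isUnit_iff_isUnit_det, isUnit_iff_ne_zero, not_not,
    Matrix.det_fin_two]
  have h : z * z + k * k = (z - k * Complex.I) * (z + k * Complex.I) := by
    linear_combination (k : ℂ) ^ 2 * Complex.I_sq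
  simp [Matrix.algebraMap_matrix_apply, h, sub_eq_zero, eq_neg_iff_add_eq_zero]

end Jacobian

/-! ### The extra singular point -/

theorem quarterChart_zero {A B C : ℝ} : quarterChart A C (-B) 0 = extraSing A B C := by
  have h : A + C + -B = A + C - B := by ring
  simp [quarterChart, extraSing, expSum, h]

theorem extraSing_equations {A B C : ℝ} (hA : 0 < A) (hB : B < 0) (hC : 0 < C) :
    0 < (extraSing A B C).1 ∧ 0 < (extraSing A B C).2 ∧
    0 < 1 - (extraSing A B C).1 ^ 2 - (extraSing A B C).2 ^ 2 ∧
    4 * A * (extraSing A B C).2 ^ 2 +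
      B * (1 - (extraSing A B C).1 ^ 2 - (extraSing A B C).2 ^ 2) ^ 2 = 0 ∧
    B * (extraSing A B C).1 ^ 2 + C * (extraSing A B C).2 ^ 2 = 0 ∧
    -4 * A * (extraSing A B C).1 ^ 2 +
      C * (1 - (extraSing A B C).1 ^ 2 - (extraSing A B C).2 ^ 2) ^ 2 = 0 := by
  have hD : 0 < -B := neg_pos.2 hB
  obtain ⟨h1, h2, h3⟩ := quarterChart_mem hA hC hD 0
  have hd := one_sub_quarterChart hA hC hD 0
  have hs : √(expSum A C (-B) 0) = √(A + C - B) := by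
    congr 1
    simp [expSum]
    ring
  rw [quarterChart_zero] at h1 h2 h3 hd
  rw [hs] at hd
  refine ⟨h1, h2, h3, ?_⟩
  rw [hd]
  have hne : √(A + C - B) + √A ≠ 0 :=
    (add_pos_of_nonneg_of_pos (Real.sqrt_nonneg _) (Real.sqrt_pos.2 hA)).ne'
  simp only [extraSing, div_pow, mul_pow, Real.sq_sqrt hA.le, Real.sq_sqrt hC.le,
    Real.sq_sqrt hD.le]
  refine ⟨?_, ?_, ?_⟩ <;> field_simp <;> ring

/-- The extra singular point is a center of the projected Kolmogorov system. -/
theorem isCenter_extraSing {A B C : ℝ} (hA : 0 < A) (hB : B < 0) (hC : 0 < C) (α β γ : ℝ) :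
    IsCenter (projectedKolmogorov α β γ A B C) (extraSing A B C) := by
  have hD : 0 < -B := neg_pos.2 hB
  obtain ⟨-, -, -, h1, h2, h3⟩ := extraSing_equations hA hB hC
  have hconj := hasDerivAt_quarterChart hA hC hD α β γ
  rw [neg_neg] at hconj
  rw [← quarterChart_zero]
  refine (isRadialPotential_expPotential hA hC hD).isCenter (continuous_timeChange hA)
    (timeChange_pos hA hC hD) isOpen_quarterDisk isBounded_quarterDisk
    (continuous_quarterChart hA) (quarterChart_mem hA hC hD)
    (continuousOn_quarterChartInv hA hC hD) (quarterChartInv_quarterChart hA hC hD)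
    (fun q hq => quarterChart_quarterChartInv hA hC hD hq) hconj ?_
  rw [quarterChart_zero]
  exact projectedKolmogorov_eq_zero h1 h2 h3

theorem mainTheorem6 (B C : ℝ) (hB : B < 0) (hC : 0 < C) :
    ∃ A₀ : ℝ, ∀ A : ℝ, 0 < A → A₀ < A → ∀ α β γ : ℝ,
      projectedKolmogorov α β γ A B C (extraSing A B C) = 0 ∧
      (∃ μ ν : ℝ, ν ≠ 0 ∧
        spectrum ℂ ((planarJacobian (projectedKolmogorov α β γ A B C)
            (extraSing A B C)).map Complex.ofReal) =
          {(μ : ℂ) + ν * Complex.I, (μ : ℂ) - ν * Complex.I}) ∧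
      (IsCenter (projectedKolmogorov α β γ A B C) (extraSing A B C) ∨
        IsFocus (projectedKolmogorov α β γ A B C) (extraSing A B C)) := by
  -- The threshold 0 suffices, with μ = 0: the frequency is positive for every A > 0 because C - B >
  -- 0 and the point lies in the open quarter disk.
  refine ⟨0, fun A hA _ α β γ => ?_⟩
  obtain ⟨hu, hv, hd, h1, h2, h3⟩ := extraSing_equations hA hB hC
  refine ⟨projectedKolmogorov_eq_zero h1 h2 h3,
    ⟨0, 8 * (extraSing A B C).1 * (extraSing A B C).2 *
      (2 * A + (C - B) * (1 - (extraSing A B C).1 ^ 2 - (extraSing A B C).2 ^ 2)), ?_, ?_⟩,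
    Or.inl (isCenter_extraSing hA hB hC α β γ)⟩
  · have hCB : 0 < C - B := by linarith
    positivity
  · rw [show planarJacobian (projectedKolmogorov α β γ A B C) (extraSing A B C) = _ from
      planarJacobian_projectedKolmogorov h1 h2 h3]
    exact spectrum_skew _
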